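/- Let $(\Omega,\mathcal F,\mathbb P)$ be a probability space with a filtration $(\mathcal F_t)_{t=0,1,\dots,T}$, let $\mathcal M=\{1,\dots,m\}$ with $m\ge 1$, let $a_1,\dots,a_m>0$ be real numbers with $\sum_{i} a_i\le 1$, and for $u=0,\dots,T$ let $X_u=[X_{1,u},\dots,X_{m,u}]$ be an integrable $\mathcal F_u$-measurable random vector. For $E\subsetneq\mathcal M$ and $k\notin E$ put $w_k(E)=a_k/(1-\sum_{i\in E}a_i)$. (In)equalities between random variables are understood almost surely. *The games.* For $t=T,T-1,\dots,0$ the stopping game $\mathcal G_t$ on $[t,T]$ is defined recursively. A strategy of a player is a stopping time with values in $\{t,\dots,T\}$. For a profile $s=[s_1,\dots,s_m]$ let $\widehat s=s_1\wedge\dots\wedge s_m$ and $E(s)=\{i: s_i=\widehat s\}$. The payoff of player $k$ is $$V_{k,t}(s)=\mathbb E\big(X_{k,\widehat s}\,1_{\{k\in E(s)\}}+\widetilde X_{k,\widehat s}\,1_{\{k\notin E(s)\}}\,\big|\,\mathcal F_t\big),\qquad \widetilde X_{k,\widehat s}=V^*_{k,\widehat s+1}-w_k(E(s))\sum_{i\in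 E(s)}\big(X_{i,\widehat s}-V^*_{i,\widehat s+1}\big)\quad(\widehat s<T),$$ where $V^*_u=[V^*_{1,u},\dots,V^*_{m,u}]$ is the value of $\mathcal G_u$, $u>t$. The value of $\mathcal G_t$ is the $\mathcal F_t$-measurable vector $V^*_t$ such that, for every $k$, $V^*_{k,t}$ is both the maximin value $\max_{s_k}\min_{s_{-k}}V_{k,t}([s_k,s_{-k}])$ (the maximum $\mathcal F_t$-measurable payoff that player $k$ can guarantee) and the minimax value $\min_{s_{-k}}\max_{s_k}V_{k,t}([s_k,s_{-k}])$ (the lowest $\mathcal F_t$-measurable payoff that the other players can force upon player $k$). A profile $s^*$ is an optimal equilibrium of $\mathcal G_t$ if for every $k$ $$V_{k,t}([s^*_k,s_{-k}])\ \ge\ V_{k,t}(s^*)\ \ge\ V_{k,t}([s_k,s^*_{-k}])\qquad\text{for all } s_k \text{ and } s_{-k}.$$ *The projection.* For a closed convex set $K\subseteq\mathbb R^m$ let $\pi_K(P)$ be the projection of $P$ onto $K$ (the point of $K$ nearest to $P$) under the norm $\big(\sum_i x_i^2/a_i+(\sum_i x_i)^2/(1-\sum_i a_i)\big)^{1/2}$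 if $\sum_i a_i<1$; if $\sum_i a_i=1$, let $\pi_K(P)=\lim_{\varepsilon\downarrow0}\pi^\varepsilon_K(P)$, where $\pi^\varepsilon_K$ is the projection onto $K$ under the norm $\big(\sum_i x_i^2/(a_i-\varepsilon/m)+(\sum_i x_i)^2/\varepsilon\big)^{1/2}$. **Theorem.** Let $O_t=\{x\in\mathbb R^m: x_i\ge X_{i,t},\ 1\le i\le m\}$, and define recursively $U_T=X_T$ and $U_t=\pi_{O_t}\big(\mathbb E(U_{t+1}\mid\mathcal F_t)\big)$ for $0\le t<T$. For $0\le t\le T$ let $\tau=[\tau_1,\dots,\tau_m]$ with $\tau_i=\inf\{u\in\{t,\dots,T\}: U_{i,u}=X_{i,u}\}$. Then every $U_t$ is integrable and $\mathcal F_t$-measurable, the games $\mathcal G_t$ are well defined (the values they refer to exist and are almost surely unique, and the random variables whose conditional expectations are the payoffs are integrable), and for every $0\le t\le T$: 1. $U_t=V_t(\tau)$, where $\tau$ is taken as a strategy profile of $\mathcal G_t$; 2. $\tau$ is an optimal equilibrium of $\mathcal G_t$, and hence $U_t=V^*_t$ is the almost surely unique value of $\mathcal G_t$. -/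

import Mathlib

open MeasureTheory Filter Topology

noncomputable section

namespace StoppingGame

/-! ### Games whose payoffs are random variables

Payoffs are real random variables, compared almost surely. All players choose their strategies from
the same set `Strat`; a profile is a function from players to strategies, and `V s k` is the payoff
of player `k` under the profile `s`. The profile `[x, s₋ₖ]` is `Function.update s k x`. -/

section Games

variable {Ω S : Type*} {mΩ : MeasurableSpace Ω} {m : ℕ}

/-- `s` is an optimal equilibrium: for every player `k`, every strategy `x` of player `k` and every
profile `s'`, one has `V_k [s_k, s'₋ₖ] ≥ V_k s ≥ V_k [x, s₋ₖ]` almost surely. -/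
def IsOptimalEquilibrium (μ : Measure Ω) (Strat : Set S)
    (V : (Fin m → S) → Fin m → Ω → ℝ) (s : Fin m → S) : Prop :=
  (∀ k, s k ∈ Strat) ∧
  ∀ k : Fin m,
    (∀ s' : Fin m → S, (∀ i, s' i ∈ Strat) →
      V s k ≤ᵐ[μ] V (Function.update s' k (s k)) k) ∧
    (∀ x ∈ Strat, V (Function.update s k x) k ≤ᵐ[μ] V s k)

/-- `v` is the maximin value `max_{s_k} min_{s₋ₖ} V_k [s_k, s₋ₖ]` of player `k`, i.e. the maximum
payoff that player `k` can guarantee. First conjunct: for some `s_k`, the minimum over `s₋ₖ` is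
attained and equals `v`. Second conjunct: no strategy `x` of player `k` guarantees more than `v`
(the payoffs `g` that `x` guarantees are measurable with respect to the information `𝓖` at the
start of the game). -/
def IsMaximin (μ : Measure Ω) (𝓖 : MeasurableSpace Ω) (Strat : Set S)
    (V : (Fin m → S) → Fin m → Ω → ℝ) (k : Fin m) (v : Ω → ℝ) : Prop :=
  (∃ s : Fin m → S, (∀ i, s i ∈ Strat) ∧ v =ᵐ[μ] V s k ∧
    ∀ s' : Fin m → S, (∀ i, s' i ∈ Strat) → v ≤ᵐ[μ] V (Function.update s' k (s k)) k) ∧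
  ∀ x ∈ Strat, ∀ g : Ω → ℝ, Measurable[𝓖] g →
    (∀ s' : Fin m → S, (∀ i, s' i ∈ Strat) → g ≤ᵐ[μ] V (Function.update s' k x) k) →
    g ≤ᵐ[μ] v

/-- `v` is the minimax value `min_{s₋ₖ} max_{s_k} V_k [s_k, s₋ₖ]` of player `k`, i.e. the lowest
payoff that the other players can force upon player `k`. First conjunct: for some `s₋ₖ`, the maximum
over `s_k` is attained and equals `v`. Second conjunct: no choice `s'₋ₖ` of the others forces
a lower payoff than `v` upon player `k`. -/
def IsMinimax (μ : Measure Ω) (𝓖 : MeasurableSpace Ω) (Strat : Set S)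
    (V : (Fin m → S) → Fin m → Ω → ℝ) (k : Fin m) (v : Ω → ℝ) : Prop :=
  (∃ s : Fin m → S, (∀ i, s i ∈ Strat) ∧ v =ᵐ[μ] V s k ∧
    ∀ x ∈ Strat, V (Function.update s k x) k ≤ᵐ[μ] v) ∧
  ∀ s' : Fin m → S, (∀ i, s' i ∈ Strat) → ∀ g : Ω → ℝ, Measurable[𝓖] g →
    (∀ x ∈ Strat, V (Function.update s' k x) k ≤ᵐ[μ] g) →
    v ≤ᵐ[μ] g

/-- The `𝓖`-measurable random vector `v` is the value of the game: for every player, `v_k` is both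
the maximin and the minimax value. -/
def IsValue (μ : Measure Ω) (𝓖 : MeasurableSpace Ω) (Strat : Set S)
    (V : (Fin m → S) → Fin m → Ω → ℝ) (v : Ω → Fin m → ℝ) : Prop :=
  ∀ k : Fin m, Measurable[𝓖] (fun ω => v ω k) ∧
    IsMaximin μ 𝓖 Strat V k (fun ω => v ω k) ∧ IsMinimax μ 𝓖 Strat V k (fun ω => v ω k)

end Games

/-! ### Projections -/

section Projection

variable {m : ℕ}

/-- The norm `(∑ x_i² / b_i + (∑ x_i)² / c) ^ (1/2)` on `ℝ^m`. -/
def wnorm (b : Fin m → ℝ) (c : ℝ) (x : Fin m → ℝ) : ℝ :=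
  Real.sqrt (∑ i, x i ^ 2 / b i + (∑ i, x i) ^ 2 / c)

/-- `Q` is a projection of `P` onto `K` under the norm `wnorm b c`. -/
def IsProj (b : Fin m → ℝ) (c : ℝ) (K : Set (Fin m → ℝ)) (P Q : Fin m → ℝ) : Prop :=
  Q ∈ K ∧ ∀ R ∈ K, wnorm b c (Q - P) ≤ wnorm b c (R - P)

/-- The projection of `P` onto `K` under the norm `wnorm b c`. It exists and is unique when `K` is
nonempty, closed and convex, and `b`, `c` are positive. -/
def normProj (b : Fin m → ℝ) (c : ℝ) (K : Set (Fin m → ℝ)) (P : Fin m → ℝ) : Fin m → ℝ :=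
  Classical.epsilon (IsProj b c K P)

open Classical in
/-- The projection `π_K(P)`. If `∑ a_i < 1` it is taken under the norm
`(∑ x_i² / a_i + (∑ x_i)² / (1 - ∑ a_i)) ^ (1/2)`. If `∑ a_i = 1` it is the limit, as `ε ↓ 0`, of the
projections under `(∑ x_i² / (a_i - ε / m) + (∑ x_i)² / ε) ^ (1/2)`. -/
def proj (a : Fin m → ℝ) (K : Set (Fin m → ℝ)) (P : Fin m → ℝ) : Fin m → ℝ :=
  if ∑ i, a i < 1 then normProj a (1 - ∑ i, a i) K P
  else limUnder (𝓝[>] (0 : ℝ)) (fun ε : ℝ => normProj (fun i => a i - ε / m) ε K P)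

/-- The orthant `{x : x_i ≥ y_i for all i}`. -/
def orthant (y : Fin m → ℝ) : Set (Fin m → ℝ) := {x | ∀ i, y i ≤ x i}

end Projection

/-! ### The multi-player stopping game -/

section Game

variable {Ω : Type*} {mΩ : MeasurableSpace Ω} {m : ℕ}

/-- The strategies in the game on `[t, T]`: stopping times with values in `[t, T]`. -/
def strategies (ℱ : Filtration ℕ mΩ) (T t : ℕ) : Set (Ω → ℕ) :=
  {σ | IsStoppingTime ℱ (fun ω => (σ ω : WithTop ℕ)) ∧ ∀ ω, t ≤ σ ω ∧ σ ω ≤ T}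

/-- The weights `w_k(E) = a_k / (1 - ∑_{i ∈ E} a_i)`. -/
def weight (a : Fin m → ℝ) (k : Fin m) (E : Finset (Fin m)) : ℝ :=
  a k / (1 - ∑ i ∈ E, a i)

/-- The minimal stopping time `ŝ = s_1 ∧ ⋯ ∧ s_m`, at which the game stops. -/
def minTime (s : Fin m → Ω → ℕ) (ω : Ω) : ℕ := ⨅ i, s i ω

/-- The exercise set `{i : s_i = ŝ}`. -/
def exerciseSet (s : Fin m → Ω → ℕ) (ω : Ω) : Finset (Fin m) :=
  {i | s i ω = minTime s ω}

open Classical in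
/-- The amount that player `k` receives when the profile `s` is played. Here `X u` is the vector
of exercise payoffs at time `u`, and `W u` is the value of the game that starts at time `u`. -/
def outcome (a : Fin m → ℝ) (X W : ℕ → Ω → Fin m → ℝ) (s : Fin m → Ω → ℕ) (k : Fin m)
    (ω : Ω) : ℝ :=
  if k ∈ exerciseSet s ω then X (minTime s ω) ω k
  else W (minTime s ω + 1) ω k - weight a k (exerciseSet s ω) *
    ∑ i ∈ exerciseSet s ω, (X (minTime s ω) ω i - W (minTime s ω + 1) ω i)

/-- The payoff of player `k` in the game on `[t, T]`: the conditional expectation, given the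
information at time `t`, of the amount received. -/
def payoff (μ : Measure Ω) (ℱ : Filtration ℕ mΩ) (a : Fin m → ℝ) (X W : ℕ → Ω → Fin m → ℝ) (t : ℕ)
    (s : Fin m → Ω → ℕ) (k : Fin m) : Ω → ℝ :=
  μ[outcome a X W s k | ℱ t]

/-- `v` is the value of the game on `[t, T]`, when the games that start at the later times `u` have
the values `W u`. -/
def IsGameValue (μ : Measure Ω) (ℱ : Filtration ℕ mΩ) (T : ℕ) (a : Fin m → ℝ)
    (X W : ℕ → Ω → Fin m → ℝ) (t : ℕ) (v : Ω → Fin m → ℝ) : Prop :=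
  IsValue μ (ℱ t) (strategies ℱ T t) (payoff μ ℱ a X W t) v

/-- For each `u` in `(t, T]`, `W u` is the value of the game on `[u, T]`. Since this game involves
only the values `W r` with `r > u`, this is a backward recursion. -/
def AreLaterValues (μ : Measure Ω) (ℱ : Filtration ℕ mΩ) (T : ℕ) (a : Fin m → ℝ)
    (X W : ℕ → Ω → Fin m → ℝ) (t : ℕ) : Prop :=
  ∀ u, t < u → u ≤ T → IsGameValue μ ℱ T a X W u (W u)

/-- The vectors `U_T = X_T` and `U_t = π_{O_t}(E[U_{t+1} | ℱ_t])` for `t < T`, where `O_t` is the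
orthant `{x : x_i ≥ X_{i,t}}`. -/
def U (μ : Measure Ω) (ℱ : Filtration ℕ mΩ) (T : ℕ) (a : Fin m → ℝ)
    (X : ℕ → Ω → Fin m → ℝ) (t : ℕ) : Ω → Fin m → ℝ :=
  if T ≤ t then X T
  else fun ω => proj a (orthant (X t ω))
    (fun i => (μ[fun ω' => U μ ℱ T a X (t + 1) ω' i | ℱ t]) ω)
termination_by T - t

/-- The profile `τ_i = inf {u ∈ [t, T] : U_{i,u} = X_{i,u}}`. -/
def tau (μ : Measure Ω) (ℱ : Filtration ℕ mΩ) (T : ℕ) (a : Fin m → ℝ)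
    (X : ℕ → Ω → Fin m → ℝ) (t : ℕ) (i : Fin m) (ω : Ω) : ℕ :=
  sInf {u | t ≤ u ∧ u ≤ T ∧ U μ ℱ T a X u ω i = X u ω i}

end Game

end StoppingGame

end

/-! Fix a time, with exercise payoffs x and expected continuation values p, and put d = x - p. Let Λ
be the largest ratio of ∑_E d to 1 - ∑_E a over proper subsets E. The Karush–Kuhn–Tucker conditions
show that the projection of p onto the orthant has coordinates max (x_i, p_i - a_i Λ)
(`normProj_eq_orthantProj`); continuity in the weights covers ∑ a = 1 (`proj_orthant_eq`).

In the one-step game where the players in E exercise, a player k outside E receives p_k minus a_k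
times the ratio of E. Since Λ dominates every ratio, exercising exactly on contact (projection
coordinate equal to x_k) secures the projection coordinate against all opponents
(`orthantProj_le_stagePayoff`). Since the contact set maximizes ∑_E (d_i + a_i Λ), opponents who
follow the same rule hold k down to that coordinate (`stagePayoff_le_orthantProj`).

Conditioning on the set of players who stop at t reduces the game on [t, T] to this one-step game
(`payoff_ae_eq_stagePayoff`), and backward induction gives both saddle inequalities for τ
(`payoff_update_tau`). A saddle point determines the value, and uniqueness of values permits
arbitrary versions of the later ones (`AreLaterValues.ae_eq_U`). -/

namespace StoppingGame

/-! ### Closed form of the projection, and the one-step game. -/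

section Projection

variable {m : ℕ}

/-- The largest of the ratios `(∑_{i ∈ E} d_i) / (1 - ∑_{i ∈ E} a_i)` over proper subsets `E`.
The full set gets the ratio `0` of the empty set. -/
noncomputable def maxRatio (a d : Fin m → ℝ) : ℝ :=
  Finset.univ.sup' Finset.univ_nonempty (fun E : Finset (Fin m) =>
    if E = Finset.univ then 0 else (∑ i ∈ E, d i) / (1 - ∑ i ∈ E, a i))

/-- Closed form of the projection of `p` onto the orthant with vertex `x`. -/
noncomputable def orthantProj (a x p : Fin m → ℝ) (i : Fin m) : ℝ :=
  max (x i) (p i - a i * maxRatio a (fun j => x j - p j))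

lemma sum_lt_one {a : Fin m → ℝ} (ha : ∀ i, 0 < a i) (hsum : ∑ i, a i ≤ 1)
    {E : Finset (Fin m)} (hE : E ≠ Finset.univ) : ∑ i ∈ E, a i < 1 := by
  obtain ⟨k, hk⟩ : ∃ k, k ∉ E := by
    by_contra! h
    exact hE (Finset.eq_univ_iff_forall.2 h)
  refine lt_of_lt_of_le ?_ hsum
  exact Finset.sum_lt_sum_of_subset (Finset.subset_univ E) (Finset.mem_univ k) hk (ha k)
    fun j _ _ => (ha j).le

lemma sum_le_maxRatio_mul {a : Fin m → ℝ} (ha : ∀ i, 0 < a i) (hsum : ∑ i, a i ≤ 1)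
    (d : Fin m → ℝ) {E : Finset (Fin m)} (hE : E ≠ Finset.univ) :
    ∑ i ∈ E, d i ≤ maxRatio a d * (1 - ∑ i ∈ E, a i) := by
  have h1 := sum_lt_one ha hsum hE
  rw [← div_le_iff₀ (by linarith)]
  have := Finset.le_sup' (fun E : Finset (Fin m) =>
    if E = Finset.univ then 0 else (∑ i ∈ E, d i) / (1 - ∑ i ∈ E, a i)) (Finset.mem_univ E)
  simp only [if_neg hE] at this
  exact this

lemma exists_sum_eq_maxRatio_mul (hm : 0 < m) {a : Fin m → ℝ} (ha : ∀ i, 0 < a i)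
    (hsum : ∑ i, a i ≤ 1) (d : Fin m → ℝ) :
    ∃ F : Finset (Fin m), F ≠ Finset.univ ∧
      ∑ i ∈ F, d i = maxRatio a d * (1 - ∑ i ∈ F, a i) := by
  obtain ⟨F, -, hF⟩ := Finset.exists_mem_eq_sup' Finset.univ_nonempty
    (fun E : Finset (Fin m) =>
      if E = Finset.univ then 0 else (∑ i ∈ E, d i) / (1 - ∑ i ∈ E, a i))
  change maxRatio a d = _ at hF
  by_cases h : F = Finset.univ
  · refine ⟨∅, fun h => ?_, ?_⟩
    · exact absurd (Finset.mem_univ (⟨0, hm⟩ : Fin m)) (by simp [← h])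
    · simp [hF, h]
  · refine ⟨F, h, ?_⟩
    have := sum_lt_one ha hsum h
    rw [if_neg h] at hF
    rw [hF, div_mul_cancel₀]
    linarith

lemma orthantProj_eq_iff {a x p : Fin m → ℝ} {i : Fin m} :
    orthantProj a x p i = x i ↔ 0 ≤ x i - p i + a i * maxRatio a (fun j => x j - p j) := by
  rw [orthantProj, max_eq_left_iff]
  constructor <;> intro h <;> linarith

/-- The contact set of the projection maximizes `∑_{i ∈ E} (d_i + a_i Λ)`. -/
lemma maxRatio_mul_le_sum_contact (hm : 0 < m) {a : Fin m → ℝ} (ha : ∀ i, 0 < a i)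
    (hsum : ∑ i, a i ≤ 1) (d : Fin m → ℝ) {E : Finset (Fin m)}
    (hE : ∀ i, i ∈ E ↔ 0 ≤ d i + a i * maxRatio a d) :
    maxRatio a d * (1 - ∑ i ∈ E, a i) ≤ ∑ i ∈ E, d i := by
  obtain ⟨F, -, hF⟩ := exists_sum_eq_maxRatio_mul hm ha hsum d
  have h1 : ∑ i ∈ F, (d i + a i * maxRatio a d) ≤ ∑ i ∈ E, (d i + a i * maxRatio a d) := by
    calc ∑ i ∈ F, (d i + a i * maxRatio a d)
        ≤ ∑ i ∈ F ∩ E, (d i + a i * maxRatio a d) := by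
          rw [← Finset.sum_inter_add_sum_sdiff F E]
          have : ∑ i ∈ F \ E, (d i + a i * maxRatio a d) ≤ 0 := by
            refine Finset.sum_nonpos fun i hi => ?_
            have := (Finset.mem_sdiff.1 hi).2
            rw [hE] at this
            linarith
          linarith
      _ ≤ _ := by
          refine Finset.sum_le_sum_of_subset_of_nonneg Finset.inter_subset_right ?_
          intro i hi _
          exact (hE i).1 hi
  rw [Finset.sum_add_distrib, Finset.sum_add_distrib, ← Finset.sum_mul, ← Finset.sum_mul] at h1
  linarith

lemma wnorm_le_iff {b : Fin m → ℝ} {c : ℝ} (hb : ∀ i, 0 < b i) (hc : 0 < c)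
    (x y : Fin m → ℝ) : wnorm b c x ≤ wnorm b c y ↔
      ∑ i, x i ^ 2 / b i + (∑ i, x i) ^ 2 / c ≤ ∑ i, y i ^ 2 / b i + (∑ i, y i) ^ 2 / c := by
  refine Real.sqrt_le_sqrt_iff (add_nonneg (Finset.sum_nonneg fun i _ => ?_) ?_)
  · exact div_nonneg (sq_nonneg _) (hb i).le
  · positivity

/-- The Karush–Kuhn–Tucker conditions identify the projection onto an orthant. -/
lemma normProj_orthant_eq {b : Fin m → ℝ} {c : ℝ} (hb : ∀ i, 0 < b i) (hc : 0 < c)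
    {x P Q l : Fin m → ℝ} {L : ℝ} (hQ : ∀ i, x i ≤ Q i) (hl : ∀ i, 0 ≤ l i)
    (hcomp : ∀ i, l i * (Q i - x i) = 0) (hQP : ∀ i, Q i - P i = b i * (l i - L))
    (hL : ∑ i, (Q i - P i) = L * c) : normProj b c (orthant x) P = Q := by
  -- Expanding the squared norm around `Q`, the terms in `L` cancel and the terms in `l` are
  -- nonnegative by complementary slackness. The surplus `∑ (R - Q)² / b` gives uniqueness as well
  -- as minimality, so the `epsilon` choice must be `Q`.
  have key : ∀ R ∈ orthant x,
      ∑ i, (Q i - P i) ^ 2 / b i + (∑ i, (Q i - P i)) ^ 2 / c + ∑ i, (R i - Q i) ^ 2 / b i ≤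
        ∑ i, (R i - P i) ^ 2 / b i + (∑ i, (R i - P i)) ^ 2 / c := by
    intro R hR
    have e1 : ∑ i, (R i - P i) = ∑ i, (Q i - P i) + ∑ i, (R i - Q i) := by
      rw [← Finset.sum_add_distrib]
      exact Finset.sum_congr rfl fun i _ => by ring
    have e2 : ∑ i, (R i - P i) ^ 2 / b i = ∑ i, (Q i - P i) ^ 2 / b i +
        ∑ i, (R i - Q i) ^ 2 / b i + 2 * ∑ i, l i * (R i - Q i) - 2 * L * ∑ i, (R i - Q i) := by
      rw [Finset.mul_sum, Finset.mul_sum, ← Finset.sum_add_distrib, ← Finset.sum_add_distrib,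
        ← Finset.sum_sub_distrib]
      refine Finset.sum_congr rfl fun i _ => ?_
      have hbi := (hb i).ne'
      have : R i - P i = b i * (l i - L) + (R i - Q i) := by rw [← hQP]; ring
      rw [this, hQP]
      field_simp
      ring
    have e3 : 0 ≤ ∑ i, l i * (R i - Q i) := by
      refine Finset.sum_nonneg fun i _ => ?_
      have : l i * (R i - Q i) = l i * (R i - x i) := by linarith [hcomp i]
      rw [this]
      exact mul_nonneg (hl i) (sub_nonneg.2 (hR i))
    have e4 : (∑ i, (R i - P i)) ^ 2 / c = (∑ i, (Q i - P i)) ^ 2 / c +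
        2 * L * ∑ i, (R i - Q i) + (∑ i, (R i - Q i)) ^ 2 / c := by
      rw [e1, hL]
      field_simp
      ring
    have e5 : 0 ≤ (∑ i, (R i - Q i)) ^ 2 / c := by positivity
    linarith
  have hproj : IsProj b c (orthant x) P Q := by
    refine ⟨hQ, fun R hR => ?_⟩
    rw [wnorm_le_iff hb hc]
    have := key R hR
    have h0 : 0 ≤ ∑ i, (R i - Q i) ^ 2 / b i :=
      Finset.sum_nonneg fun i _ => div_nonneg (sq_nonneg _) (hb i).le
    simp only [Pi.sub_apply]
    linarith
  have hspec : IsProj b c (orthant x) P (normProj b c (orthant x) P) :=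
    Classical.epsilon_spec (p := IsProj b c (orthant x) P) ⟨Q, hproj⟩
  set R := normProj b c (orthant x) P
  have h1 := key R hspec.1
  have h2 := (wnorm_le_iff hb hc _ _).1 (hspec.2 Q hQ)
  simp only [Pi.sub_apply] at h2
  have h3 : ∑ i, (R i - Q i) ^ 2 / b i = 0 :=
    le_antisymm (by linarith)
      (Finset.sum_nonneg fun i _ => div_nonneg (sq_nonneg _) (hb i).le)
  rw [Finset.sum_eq_zero_iff_of_nonneg
    (fun i _ => div_nonneg (sq_nonneg _) (hb i).le)] at h3
  funext i
  have h4 := h3 i (Finset.mem_univ i)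
  rw [div_eq_zero_iff, or_iff_left (hb i).ne', sq_eq_zero_iff] at h4
  linarith

/-- The multiplier `L` is `Λ` when the contact set is proper. On full contact the projection is the
vertex and `L = (∑ d) / c`, which may exceed `Λ` because the full set does not compete in the
maximum. -/
lemma normProj_eq_orthantProj (hm : 0 < m) {a : Fin m → ℝ} (ha : ∀ i, 0 < a i) {c : ℝ}
    (hc : 0 < c) (hac : ∑ i, a i = 1 - c) (x p : Fin m → ℝ) :
    normProj a c (orthant x) p = orthantProj a x p := by
  have hsum : ∑ i, a i ≤ 1 := by linarith
  set d : Fin m → ℝ := fun j => x j - p j with hd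
  set Λ := maxRatio a d with hΛ
  set E : Finset (Fin m) := {i | 0 ≤ d i + a i * Λ} with hE
  have hmem : ∀ i, i ∈ E ↔ 0 ≤ d i + a i * Λ := fun i => by simp [hE]
  have hge := maxRatio_mul_le_sum_contact hm ha hsum d hmem
  have hQ : ∀ i, orthantProj a x p i = max (x i) (p i - a i * Λ) := fun i => rfl
  by_cases hu : E = Finset.univ
  · rw [hu, hac] at hge
    have hEq : ∀ i, orthantProj a x p i = x i := fun i => by
      rw [orthantProj_eq_iff]
      exact (hmem i).1 (by simp [hu])
    have hle : Λ ≤ (∑ i, d i) / c := by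
      rw [le_div_iff₀ hc]; linarith
    refine normProj_orthant_eq ha hc (l := fun i => d i / a i + (∑ i, d i) / c)
      (L := (∑ i, d i) / c) (fun i => (hEq i).ge) (fun i => ?_) (fun i => ?_) (fun i => ?_) ?_
    · have h1 : 0 ≤ d i + a i * Λ := (hmem i).1 (by simp [hu])
      have h2 : d i / a i + Λ = (d i + a i * Λ) / a i := by
        have := (ha i).ne'
        field_simp
      have h3 := div_nonneg h1 (ha i).le
      linarith
    · simp [hEq]
    · have := (ha i).ne'
      rw [hEq]
      field_simp
      simp [hd]
    · rw [div_mul_cancel₀ _ hc.ne']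
      exact Finset.sum_congr rfl fun i _ => by rw [hEq]
  · have heq := le_antisymm (sum_le_maxRatio_mul ha hsum d hu) hge
    -- A proper contact set attains the ratio `Λ`; in this form the equality is the stationarity
    -- condition `∑ (Q - P) = Λ * c`.
    have hsumE : ∑ i, max 0 (d i + a i * Λ) = Λ := by
      have : ∑ i, max 0 (d i + a i * Λ) = ∑ i ∈ E, (d i + a i * Λ) := by
        rw [hE, Finset.sum_filter]
        refine Finset.sum_congr rfl fun i _ => ?_
        split_ifs with h
        · exact max_eq_right h
        · exact max_eq_left (not_le.1 h).le
      rw [this, Finset.sum_add_distrib, ← Finset.sum_mul, heq]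
      ring
    have hdiff : ∀ i, orthantProj a x p i - p i = max 0 (d i + a i * Λ) - a i * Λ := fun i => by
      rw [hQ, hd]
      rcases le_total (x i) (p i - a i * Λ) with h | h
      · rw [max_eq_right h, max_eq_left (by linarith)]; ring
      · rw [max_eq_left h, max_eq_right (by linarith)]; ring
    refine normProj_orthant_eq ha hc (l := fun i => max 0 (d i + a i * Λ) / a i) (L := Λ)
      (fun i => le_max_left _ _) (fun i => div_nonneg (le_max_left _ _) (ha i).le)
      (fun i => ?_) (fun i => ?_) ?_
    · rcases le_total 0 (d i + a i * Λ) with h | h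
      · rw [orthantProj_eq_iff.2 h]; simp
      · rw [max_eq_left h]; simp
    · have := (ha i).ne'
      rw [hdiff]
      field_simp
    · rw [Finset.sum_congr rfl fun i _ => hdiff i, Finset.sum_sub_distrib, hsumE,
        ← Finset.sum_mul, hac]
      ring

lemma continuous_maxRatio (a : Fin m → ℝ) : Continuous (maxRatio a) := by
  unfold maxRatio
  refine Continuous.finset_sup'_apply _ fun E _ => ?_
  split_ifs
  · exact continuous_const
  · fun_prop

/-- Only proper subsets contribute denominators, and these stay positive at `a` even if the weights
sum to 1. -/
lemma continuousAt_maxRatio {a : Fin m → ℝ} (ha : ∀ i, 0 < a i) (hsum : ∑ i, a i ≤ 1)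
    (d : Fin m → ℝ) : ContinuousAt (fun b => maxRatio b d) a := by
  unfold maxRatio
  refine ContinuousAt.finset_sup'_apply _ fun E _ => ?_
  by_cases hE : E = Finset.univ
  · simp only [hE, if_true]
    exact continuousAt_const
  · simp only [hE, if_false]
    refine ContinuousAt.div continuousAt_const (by fun_prop) ?_
    have := sum_lt_one ha hsum hE
    linarith

/-- In the degenerate case the perturbed weights sum to `1 - ε`, so for small `ε` the closed form
applies to them and passes to the limit. -/
theorem proj_orthant_eq (hm : 0 < m) {a : Fin m → ℝ} (ha : ∀ i, 0 < a i)
    (hsum : ∑ i, a i ≤ 1) (x p : Fin m → ℝ) :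
    proj a (orthant x) p = orthantProj a x p := by
  have hm' : (m : ℝ) ≠ 0 := by exact_mod_cast hm.ne'
  unfold proj
  split_ifs with h
  · exact normProj_eq_orthantProj hm ha (by linarith) (by ring) x p
  · have h1 : ∑ i, a i = 1 := le_antisymm hsum (not_lt.1 h)
    have hcont : Tendsto (fun ε : ℝ => fun i => a i - ε / m) (𝓝[>] 0) (𝓝 a) := by
      have : Continuous (fun ε : ℝ => fun i => a i - ε / m) := by fun_prop
      have := this.tendsto 0
      simp only [zero_div, sub_zero] at this
      exact this.mono_left nhdsWithin_le_nhds
    have hlim : Tendsto (fun ε : ℝ => orthantProj (fun i => a i - ε / m) x p) (𝓝[>] 0)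
        (𝓝 (orthantProj a x p)) := by
      refine Tendsto.comp (g := fun b => orthantProj b x p) ?_ hcont
      refine tendsto_pi_nhds.2 fun i => ?_
      have h2 : ContinuousAt (fun b : Fin m → ℝ => b i) a := (continuous_apply i).continuousAt
      have : ContinuousAt (fun b => orthantProj b x p i) a :=
        continuousAt_const.max (continuousAt_const.sub
          (h2.mul (continuousAt_maxRatio ha hsum fun j => x j - p j)))
      exact this
    refine Tendsto.limUnder_eq (hlim.congr' ?_)
    have hpos : ∀ᶠ ε : ℝ in 𝓝[>] 0, ∀ i, 0 < a i - ε / m := by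
      refine eventually_all.2 fun i => ?_
      exact (tendsto_pi_nhds.1 hcont i).eventually (lt_mem_nhds (ha i))
    filter_upwards [hpos, self_mem_nhdsWithin] with ε hε hε0
    refine (normProj_eq_orthantProj hm hε hε0 ?_ x p).symm
    rw [Finset.sum_sub_distrib, h1]
    simp
    field_simp

open Classical in
/-- Payoff of player `k` when exactly the players in `E` exercise, the exercise payoffs are `x`
and the continuation values are `p`. -/
noncomputable def stagePayoff (a x p : Fin m → ℝ) (E : Finset (Fin m)) (k : Fin m) : ℝ :=
  if k ∈ E then x k else p k - weight a k E * ∑ i ∈ E, (x i - p i)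

/-- Off contact, player `k` loses `a k` times the ratio of `E`, which is at most `a k * Λ`. Only the
behaviour of `k` is constrained. -/
lemma orthantProj_le_stagePayoff {a : Fin m → ℝ} (ha : ∀ i, 0 < a i)
    (hsum : ∑ i, a i ≤ 1) (x p : Fin m → ℝ) {E : Finset (Fin m)} {k : Fin m}
    (hk : k ∈ E ↔ orthantProj a x p k = x k) :
    orthantProj a x p k ≤ stagePayoff a x p E k := by
  unfold stagePayoff
  split_ifs with h
  · exact (hk.1 h).le
  · have hE : E ≠ Finset.univ := fun h' => h (h' ▸ Finset.mem_univ k)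
    have h1 := sum_le_maxRatio_mul ha hsum (fun j => x j - p j) hE
    have h2 := sum_lt_one ha hsum hE
    have h3 : orthantProj a x p k = p k - a k * maxRatio a (fun j => x j - p j) :=
      (max_choice _ _).resolve_left fun h' => h (hk.2 h')
    rw [h3, weight, div_mul_eq_mul_div, mul_div_assoc]
    refine sub_le_sub_left (mul_le_mul_of_nonneg_left ?_ (ha k).le) _
    rw [div_le_iff₀ (by linarith)]
    exact h1

/-- If `k` is off contact and abstains, `E` is the contact set and its ratio is at least `Λ`. The
delicate case is a player in contact who abstains: then `insert k E` is the contact set, possibly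
full with total weight 1, so its inequality is used without dividing. -/
lemma stagePayoff_le_orthantProj (hm : 0 < m) {a : Fin m → ℝ} (ha : ∀ i, 0 < a i)
    (hsum : ∑ i, a i ≤ 1) (x p : Fin m → ℝ) {E : Finset (Fin m)} {k : Fin m}
    (hk : ∀ i ≠ k, i ∈ E ↔ orthantProj a x p i = x i) :
    stagePayoff a x p E k ≤ orthantProj a x p k := by
  unfold stagePayoff
  split_ifs with h
  · exact le_max_left _ _
  have hE : E ≠ Finset.univ := fun h' => h (h' ▸ Finset.mem_univ k)
  have h2 := sum_lt_one ha hsum hE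
  set d : Fin m → ℝ := fun j => x j - p j with hd
  have hdist : ∀ i, orthantProj a x p i = x i ↔ 0 ≤ d i + a i * maxRatio a d :=
    fun i => orthantProj_eq_iff
  rw [weight, div_mul_eq_mul_div]
  by_cases hc : orthantProj a x p k = x k
  · rw [hc]
    have h1 := maxRatio_mul_le_sum_contact hm ha hsum d (E := insert k E) (fun i => by
      rw [Finset.mem_insert, ← hdist]
      by_cases hik : i = k
      · simp [hik, hc]
      · simp [hik, hk i hik])
    have hle : ∑ i ∈ insert k E, a i ≤ 1 :=
      (Finset.sum_le_sum_of_subset_of_nonneg (Finset.subset_univ _)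
        fun i _ _ => (ha i).le).trans hsum
    rw [Finset.sum_insert h] at h1 hle
    rw [Finset.sum_insert h] at h1
    have hdk := (hdist k).1 hc
    have : p k - x k ≤ a k * ∑ i ∈ E, d i / 1 / (1 - ∑ i ∈ E, a i) := by
      rw [← Finset.sum_div, ← mul_div_assoc, le_div_iff₀ (by linarith)]
      simp only [div_one]
      have e : p k - x k = - d k := by simp [hd]
      rw [e]
      -- Adding `a k` times `h1` to the product of `d k + a k * Λ ≥ 0` and the weight left outside
      -- `insert k E` eliminates `Λ`.
      nlinarith [mul_le_mul_of_nonneg_left h1 (ha k).le,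
        mul_nonneg hdk (sub_nonneg.2 hle)]
    rw [← Finset.sum_div, ← mul_div_assoc] at this
    simp only [div_one] at this
    linarith
  · have hE' : ∀ i, i ∈ E ↔ 0 ≤ d i + a i * maxRatio a d := fun i => by
      rw [← hdist]
      by_cases hik : i = k
      · subst hik; simp [h, hc]
      · exact hk i hik
    have h1 := maxRatio_mul_le_sum_contact hm ha hsum d hE'
    refine le_trans (sub_le_sub_left ?_ _) (le_max_right _ _)
    rw [mul_div_assoc]
    refine mul_le_mul_of_nonneg_left ?_ (ha k).le
    rw [le_div_iff₀ (by linarith)]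
    exact h1

end Projection

/-! ### Equilibria and uniqueness of values. -/

section Games

variable {Ω S : Type*} {mΩ : MeasurableSpace Ω} {m : ℕ} {μ : Measure Ω} {Strat : Set S}
  {V : (Fin m → S) → Fin m → Ω → ℝ}

lemma update_mem {s : Fin m → S} (hs : ∀ i, s i ∈ Strat) (k : Fin m) {x : S} (hx : x ∈ Strat) :
    ∀ i, Function.update s k x i ∈ Strat := by
  intro i
  by_cases h : i = k
  · subst h; simpa using hx
  · simpa [h] using hs i

lemma IsOptimalEquilibrium.isValue {𝓖 : MeasurableSpace Ω} {s : Fin m → S} {v : Ω → Fin m → ℝ}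
    (h : IsOptimalEquilibrium μ Strat V s) (hv : ∀ k, Measurable[𝓖] (fun ω => v ω k))
    (hvs : ∀ k, (fun ω => v ω k) =ᵐ[μ] V s k) : IsValue μ 𝓖 Strat V v := by
  obtain ⟨hs, h⟩ := h
  refine fun k => ⟨hv k, ⟨⟨s, hs, hvs k, fun s' hs' => (hvs k).le.trans ((h k).1 s' hs')⟩,
    fun x hx g _ hg => ((hg s hs).trans ((h k).2 x hx)).trans (hvs k).symm.le⟩,
    ⟨⟨s, hs, hvs k, fun x hx => ((h k).2 x hx).trans (hvs k).symm.le⟩,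
    fun s' hs' g _ hg => ((hvs k).le.trans ((h k).1 s' hs')).trans (hg _ (hs k))⟩⟩

/-- Some strategy guarantees `v`; as `v` is `𝓖`-measurable, it competes in the maximality clause for
`v'`. -/
lemma IsValue.ae_le {𝓖 : MeasurableSpace Ω} {v v' : Ω → Fin m → ℝ}
    (h : IsValue μ 𝓖 Strat V v) (h' : IsValue μ 𝓖 Strat V v') (k : Fin m) :
    (fun ω => v ω k) ≤ᵐ[μ] (fun ω => v' ω k) := by
  obtain ⟨s, hs, -, hg⟩ := (h k).2.1.1
  exact (h' k).2.1.2 (s k) (hs k) _ (h k).1 hg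

lemma IsValue.ae_eq {𝓖 : MeasurableSpace Ω} {v v' : Ω → Fin m → ℝ}
    (h : IsValue μ 𝓖 Strat V v) (h' : IsValue μ 𝓖 Strat V v') (k : Fin m) :
    (fun ω => v ω k) =ᵐ[μ] (fun ω => v' ω k) :=
  (h.ae_le h' k).antisymm (h'.ae_le h k)

end Games

/-! ### Integrability and conditional expectations of one-step payoffs. -/

section MeasureTheory

variable {Ω : Type*} {mΩ : MeasurableSpace Ω} {μ : Measure Ω}

/-- Integrability is asked only on cells that occur: stopping at `T` with a proper exercise set
would involve the uncontrolled `W (T + 1)`, but never happens. -/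
lemma integrable_of_finite_partition {ι : Type*} (J : Finset ι) {c : Ω → ι}
    (hcJ : ∀ ω, c ω ∈ J) {f : Ω → ℝ} (g : ι → Ω → ℝ) (hfg : ∀ ω, f ω = g (c ω) ω)
    (hc : ∀ j ∈ J, MeasurableSet {ω | c ω = j})
    (hg : ∀ j ∈ J, (∃ ω, c ω = j) → Integrable (g j) μ) : Integrable f μ := by
  classical
  have hf : f = fun ω => ∑ j ∈ J, Set.indicator {ω | c ω = j} (g j) ω := by
    funext ω
    rw [Finset.sum_eq_single (c ω)]
    · rw [Set.indicator_of_mem (by simp), hfg]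
    · intro j _ hj
      exact Set.indicator_of_notMem (fun h => hj (by simpa using h.symm)) _
    · exact fun h => absurd (hcJ ω) h
  rw [hf]
  refine integrable_finsetSum J fun j hj => ?_
  by_cases h : ∃ ω, c ω = j
  · exact (hg j hj h).indicator (hc j hj)
  · have : {ω | c ω = j} = ∅ := by
      ext ω
      simpa using fun hω => h ⟨ω, hω⟩
    rw [this, Set.indicator_empty]
    exact integrable_zero _ _ _

lemma condExp_congr_on {𝓖 : MeasurableSpace Ω} {f g : Ω → ℝ} (hf : Integrable f μ)
    (hg : Integrable g μ) {A : Set Ω} (hA : MeasurableSet[𝓖] A) (hfg : ∀ ω ∈ A, f ω = g ω) :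
    ∀ᵐ ω ∂μ, ω ∈ A → (μ[f | 𝓖]) ω = (μ[g | 𝓖]) ω := by
  have h : A.indicator f = A.indicator g := Set.indicator_congr hfg
  have h1 := condExp_indicator hf hA
  have h2 := condExp_indicator hg hA
  rw [h] at h1
  filter_upwards [h1, h2] with ω e1 e2 hω
  rw [e1, Set.indicator_of_mem hω, Set.indicator_of_mem hω] at e2
  exact e2

lemma integrable_maxRatio {m : ℕ} (a : Fin m → ℝ) {d : Ω → Fin m → ℝ}
    (hd : ∀ i, Integrable (fun ω => d ω i) μ) : Integrable (fun ω => maxRatio a (d ω)) μ := by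
  have : (fun ω => maxRatio a (d ω)) = Finset.univ.sup' Finset.univ_nonempty
      (fun (E : Finset (Fin m)) ω =>
        if E = Finset.univ then 0 else (∑ i ∈ E, d ω i) / (1 - ∑ i ∈ E, a i)) := by
    funext ω
    rw [Finset.sup'_apply]
    rfl
  rw [this]
  refine Finset.sup'_induction (p := fun f => Integrable f μ) _ _
    (fun f hf g hg => hf.sup hg) fun E _ => ?_
  split_ifs
  · exact integrable_zero _ _ _
  · exact (integrable_finsetSum E fun i _ => hd i).div_const _

lemma integrable_stagePayoff {m : ℕ} (a : Fin m → ℝ) {x p : Ω → Fin m → ℝ}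
    (hx : ∀ i, Integrable (fun ω => x ω i) μ) (hp : ∀ i, Integrable (fun ω => p ω i) μ)
    (E : Finset (Fin m)) (k : Fin m) :
    Integrable (fun ω => stagePayoff a (x ω) (p ω) E k) μ := by
  unfold stagePayoff
  split_ifs
  · exact hx k
  · exact (hp k).sub ((integrable_finsetSum E fun i _ => (hx i).sub (hp i)).const_mul _)

/-- For fixed `E` the payoff is affine in `(x, p)`, and `x` is already known to `𝓖`. -/
lemma condExp_stagePayoff {m : ℕ} {𝓖 : MeasurableSpace Ω} (h𝓖 : 𝓖 ≤ mΩ) [IsFiniteMeasure μ]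
    (a : Fin m → ℝ) {x p : Ω → Fin m → ℝ}
    (hxm : ∀ i, Measurable[𝓖] (fun ω => x ω i))
    (hx : ∀ i, Integrable (fun ω => x ω i) μ) (hp : ∀ i, Integrable (fun ω => p ω i) μ)
    (E : Finset (Fin m)) (k : Fin m) :
    μ[fun ω => stagePayoff a (x ω) (p ω) E k | 𝓖] =ᵐ[μ]
      fun ω => stagePayoff a (x ω) (fun i => (μ[fun ω' => p ω' i | 𝓖]) ω) E k := by
  have hxc : ∀ i, μ[fun ω => x ω i | 𝓖] = fun ω => x ω i := fun i =>
    condExp_of_stronglyMeasurable h𝓖 (hxm i).stronglyMeasurable (hx i)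
  unfold stagePayoff
  split_ifs
  · rw [hxc]
  · have hdi : ∀ i ∈ E, Integrable (fun ω => x ω i - p ω i) μ := fun i _ => (hx i).sub (hp i)
    have h1 := condExp_sub (hp k)
      ((integrable_finsetSum E hdi).const_mul (weight a k E)) 𝓖
    have h2 := condExp_smul (μ := μ) (weight a k E) (fun ω => ∑ i ∈ E, (x ω i - p ω i)) 𝓖
    have h3 := condExp_finsetSum hdi 𝓖
    have h4 : ∀ᵐ ω ∂μ, ∀ i, (μ[fun ω => x ω i - p ω i | 𝓖]) ω =
        x ω i - (μ[fun ω' => p ω' i | 𝓖]) ω := by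
      refine ae_all_iff.2 fun i => ?_
      filter_upwards [condExp_sub (hx i) (hp i) 𝓖] with ω hω
      rw [hxc] at hω
      exact hω
    have h5 : (∑ i ∈ E, fun ω => x ω i - p ω i) = fun ω => ∑ i ∈ E, (x ω i - p ω i) := by
      funext ω; simp
    rw [h5] at h3
    filter_upwards [h1, h2, h3, h4] with ω e1 e2 e3 e4
    refine e1.trans ?_
    simp only [Pi.sub_apply]
    congr 1
    refine e2.trans ?_
    rw [Pi.smul_apply, e3, Finset.sum_apply, smul_eq_mul]
    simp only [e4]

end MeasureTheory

/-! ### Reduction of the stopping game to one step, and backward induction. -/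

section Game

variable {Ω : Type*} {mΩ : MeasurableSpace Ω} {m : ℕ} {μ : Measure Ω} {ℱ : Filtration ℕ mΩ}
  {T : ℕ} {a : Fin m → ℝ} {X W : ℕ → Ω → Fin m → ℝ}

lemma minTime_le (s : Fin m → Ω → ℕ) (ω : Ω) (i : Fin m) : minTime s ω ≤ s i ω :=
  ciInf_le (OrderBot.bddBelow _) i

lemma exists_eq_minTime (hm : 0 < m) (s : Fin m → Ω → ℕ) (ω : Ω) :
    ∃ i, s i ω = minTime s ω := by
  have : Nonempty (Fin m) := ⟨⟨0, hm⟩⟩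
  exact exists_eq_ciInf_of_finite

lemma outcome_eq_stagePayoff (s : Fin m → Ω → ℕ) (k : Fin m) (ω : Ω) :
    outcome a X W s k ω = stagePayoff a (X (minTime s ω) ω) (W (minTime s ω + 1) ω)
      (exerciseSet s ω) k := rfl

lemma outcome_congr {s s' : Fin m → Ω → ℕ} {ω : Ω} (h : ∀ i, s i ω = s' i ω) (k : Fin m) :
    outcome a X W s k ω = outcome a X W s' k ω := by
  have h1 : minTime s ω = minTime s' ω := by simp only [minTime, h]
  have h2 : exerciseSet s ω = exerciseSet s' ω := by simp only [exerciseSet, h1, h]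
  rw [outcome_eq_stagePayoff, outcome_eq_stagePayoff, h1, h2]

lemma minTime_mem_Icc (hm : 0 < m) {t : ℕ} {s : Fin m → Ω → ℕ}
    (hs : ∀ i, s i ∈ strategies ℱ T t) (ω : Ω) : t ≤ minTime s ω ∧ minTime s ω ≤ T := by
  obtain ⟨i, hi⟩ := exists_eq_minTime hm s ω
  rw [← hi]
  exact (hs i).2 ω

lemma exerciseSet_eq_univ {t : ℕ} {s : Fin m → Ω → ℕ}
    (hs : ∀ i, s i ∈ strategies ℱ T t) {ω : Ω} (h : minTime s ω = T) :
    exerciseSet s ω = Finset.univ := by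
  refine Finset.eq_univ_iff_forall.2 fun i => ?_
  simp only [exerciseSet, Finset.mem_filter, Finset.mem_univ, true_and]
  exact le_antisymm (h ▸ ((hs i).2 ω).2) (minTime_le s ω i)

lemma isStoppingTime_natCast_iff {σ : Ω → ℕ} :
    IsStoppingTime ℱ (fun ω => (σ ω : WithTop ℕ)) ↔ ∀ u, MeasurableSet[ℱ u] {ω | σ ω ≤ u} := by
  refine forall_congr' fun u => ?_
  have : {ω | (σ ω : WithTop ℕ) ≤ (u : ℕ)} = {ω | σ ω ≤ u} := by
    ext ω
    exact WithTop.coe_le_coe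
  exact iff_of_eq (congrArg _ this)

lemma measurable_of_mem_strategies {t : ℕ} {σ : Ω → ℕ} (hσ : σ ∈ strategies ℱ T t) :
    Measurable σ := by
  refine measurable_to_countable' fun u => ?_
  have := ℱ.le u _ (hσ.1.measurableSet_eq u)
  convert this using 1
  ext ω
  simp

theorem integrable_outcome (hm : 0 < m) {t : ℕ}
    (hXint : ∀ u ≤ T, ∀ i, Integrable (fun ω => X u ω i) μ)
    (hWint : ∀ u, t < u → u ≤ T → ∀ i, Integrable (fun ω => W u ω i) μ)
    {s : Fin m → Ω → ℕ} (hs : ∀ i, s i ∈ strategies ℱ T t) (k : Fin m) :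
    Integrable (outcome a X W s k) μ := by
  refine integrable_of_finite_partition (Finset.Icc t T ×ˢ Finset.univ)
    (c := fun ω => (minTime s ω, exerciseSet s ω))
    (fun ω => ?_) (fun j ω => stagePayoff a (X j.1 ω) (W (j.1 + 1) ω) j.2 k) (fun ω => rfl)
    (fun j _ => ?_) fun j hj hω => ?_
  · simpa using minTime_mem_Icc hm hs ω
  · have h1 : Measurable (fun ω i => s i ω) :=
      measurable_pi_iff.2 fun i => measurable_of_mem_strategies (hs i)
    have h2 : MeasurableSet {v : Fin m → ℕ | ((⨅ i, v i),
        ({i | v i = ⨅ i, v i} : Finset (Fin m))) = j} := MeasurableSet.of_discrete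
    exact h1 h2
  · obtain ⟨u, E⟩ := j
    obtain ⟨ω, hω⟩ := hω
    simp only [Prod.mk.injEq] at hω
    simp only [Finset.mem_product, Finset.mem_Icc, Finset.mem_univ, and_true] at hj
    rcases hj.2.eq_or_lt with h | h
    · have hE : E = Finset.univ := by
        rw [← hω.2]; exact exerciseSet_eq_univ hs (hω.1.trans h)
      simpa [stagePayoff, hE] using hXint u hj.2 k
    · exact integrable_stagePayoff a (hXint u hj.2) (hWint (u + 1) (by omega) h) E k

lemma payoff_last (hm : 0 < m) [IsFiniteMeasure μ]
    (hXmeas : ∀ i, Measurable[ℱ T] (fun ω => X T ω i))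
    (hXint : ∀ i, Integrable (fun ω => X T ω i) μ)
    {s : Fin m → Ω → ℕ} (hs : ∀ i, s i ∈ strategies ℱ T T) (k : Fin m) :
    payoff μ ℱ a X W T s k = fun ω => X T ω k := by
  have : outcome a X W s k = fun ω => X T ω k := by
    funext ω
    have h1 := minTime_mem_Icc hm hs ω
    have h2 : minTime s ω = T := le_antisymm h1.2 h1.1
    rw [outcome_eq_stagePayoff, exerciseSet_eq_univ hs h2, h2]
    simp [stagePayoff]
  rw [payoff, this]
  exact condExp_of_stronglyMeasurable (ℱ.le T) (hXmeas k).stronglyMeasurable (hXint k)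

/-- The payoff in terms of the set of players who exercise immediately. -/
theorem payoff_ae_eq_stagePayoff (hm : 0 < m) [IsFiniteMeasure μ] {t : ℕ} (ht : t < T)
    (hXmeas : ∀ i, Measurable[ℱ t] (fun ω => X t ω i))
    (hXint : ∀ u ≤ T, ∀ i, Integrable (fun ω => X u ω i) μ)
    (hWint : ∀ u, t < u → u ≤ T → ∀ i, Integrable (fun ω => W u ω i) μ)
    {s s' : Fin m → Ω → ℕ} (hs : ∀ i, s i ∈ strategies ℱ T t)
    (hs' : ∀ i, s' i ∈ strategies ℱ T (t + 1))
    (hss' : ∀ ω, (∀ i, s i ω ≠ t) → ∀ i, s i ω = s' i ω) (k : Fin m) :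
    ∀ᵐ ω ∂μ, payoff μ ℱ a X W t s k ω = if ∀ i, s i ω ≠ t
      then (μ[payoff μ ℱ a X W (t + 1) s' k | ℱ t]) ω
      else stagePayoff a (X t ω) (fun i => (μ[fun ω' => W (t + 1) ω' i | ℱ t]) ω)
        {i | s i ω = t} k := by
  have hA : ∀ E : Finset (Fin m), MeasurableSet[ℱ t] {ω | ∀ i, s i ω = t ↔ i ∈ E} := by
    intro E
    have hi : ∀ i, MeasurableSet[ℱ t] {ω | s i ω = t} := fun i => by
      have := (hs i).1.measurableSet_eq t
      convert this using 1
      ext ω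
      simp
    rw [Set.ofPred_forall]
    refine MeasurableSet.iInter fun i => ?_
    by_cases h : i ∈ E
    · simpa [h] using hi i
    · simp only [h, iff_false]
      exact (hi i).compl
  have hout := integrable_outcome (a := a) hm hXint hWint hs k
  have hout' := integrable_outcome (a := a) (t := t + 1) hm hXint
    (fun u hu => hWint u (by omega)) hs' k
  -- The index `∅` is the event that nobody stops at `t`, where the two profiles agree.
  have hcont := condExp_congr_on hout hout' (hA ∅) (fun ω hω =>
    outcome_congr (hss' ω fun i hi => by simpa using (hω i).1 hi) k)
  have htower : μ[payoff μ ℱ a X W (t + 1) s' k | ℱ t] =ᵐ[μ] μ[outcome a X W s' k | ℱ t] :=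
    condExp_condExp_of_le (ℱ.mono (Nat.le_succ t)) (ℱ.le (t + 1))
  have hexer : ∀ᵐ ω ∂μ, ∀ E : Finset (Fin m), E.Nonempty → ω ∈ {ω | ∀ i, s i ω = t ↔ i ∈ E} →
      payoff μ ℱ a X W t s k ω =
        (μ[fun ω => stagePayoff a (X t ω) (W (t + 1) ω) E k | ℱ t]) ω := by
    refine ae_all_iff.2 fun E => ?_
    by_cases hE : E.Nonempty
    · filter_upwards [condExp_congr_on hout (integrable_stagePayoff a (hXint t ht.le)
        (hWint (t + 1) (by omega) ht) E k) (hA E) (fun ω hω => by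
          obtain ⟨j, hj⟩ := hE
          have h1 : minTime s ω = t :=
            le_antisymm (((hω j).2 hj) ▸ minTime_le s ω j) (minTime_mem_Icc hm hs ω).1
          have h2 : exerciseSet s ω = E := by
            ext i
            simp [exerciseSet, h1, hω i]
          rw [outcome_eq_stagePayoff, h1, h2])] with ω hω _ using hω
    · exact Eventually.of_forall fun ω h => absurd h hE
  have hlin := ae_all_iff.2 fun E : Finset (Fin m) =>
    condExp_stagePayoff (μ := μ) (ℱ.le t) a hXmeas (hXint t ht.le)
      (hWint (t + 1) (by omega) ht) E k
  filter_upwards [hcont, htower, hexer, hlin] with ω e1 e2 e3 e4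
  split_ifs with h
  · rw [e2]
    exact e1 fun i => by simp [h i]
  · push Not at h
    obtain ⟨j, hj⟩ := h
    rw [e3 {i | s i ω = t} ⟨j, by simpa using hj⟩ (fun i => by simp), e4]

/-- If nobody stops, the one-step payoff with `E = ∅` is the expected continuation value, so one
formula bounds both branches. -/
theorem stagePayoff_le_payoff (hm : 0 < m) [IsFiniteMeasure μ] {t : ℕ} (ht : t < T)
    (hXmeas : ∀ i, Measurable[ℱ t] (fun ω => X t ω i))
    (hXint : ∀ u ≤ T, ∀ i, Integrable (fun ω => X u ω i) μ)
    (hWint : ∀ u, t < u → u ≤ T → ∀ i, Integrable (fun ω => W u ω i) μ)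
    {s s' : Fin m → Ω → ℕ} (hs : ∀ i, s i ∈ strategies ℱ T t)
    (hs' : ∀ i, s' i ∈ strategies ℱ T (t + 1))
    (hss' : ∀ ω, (∀ i, s i ω ≠ t) → ∀ i, s i ω = s' i ω) (k : Fin m)
    (hle : (fun ω => W (t + 1) ω k) ≤ᵐ[μ] payoff μ ℱ a X W (t + 1) s' k) :
    (fun ω => stagePayoff a (X t ω) (fun i => (μ[fun ω' => W (t + 1) ω' i | ℱ t]) ω)
        {i | s i ω = t} k) ≤ᵐ[μ] payoff μ ℱ a X W t s k := by
  filter_upwards [payoff_ae_eq_stagePayoff (a := a) hm ht hXmeas hXint hWint hs hs' hss' k,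
    condExp_mono (m := ℱ t) (hWint (t + 1) (by omega) ht k) integrable_condExp hle] with ω e1 e2
  rw [e1]
  split_ifs with h
  · have hE : ({i | s i ω = t} : Finset (Fin m)) = ∅ := by simp [h]
    rw [hE]
    simp only [stagePayoff, Finset.notMem_empty, if_false, Finset.sum_empty, mul_zero, sub_zero]
    exact e2
  · exact le_rfl

theorem payoff_le_stagePayoff (hm : 0 < m) [IsFiniteMeasure μ] {t : ℕ} (ht : t < T)
    (hXmeas : ∀ i, Measurable[ℱ t] (fun ω => X t ω i))
    (hXint : ∀ u ≤ T, ∀ i, Integrable (fun ω => X u ω i) μ)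
    (hWint : ∀ u, t < u → u ≤ T → ∀ i, Integrable (fun ω => W u ω i) μ)
    {s s' : Fin m → Ω → ℕ} (hs : ∀ i, s i ∈ strategies ℱ T t)
    (hs' : ∀ i, s' i ∈ strategies ℱ T (t + 1))
    (hss' : ∀ ω, (∀ i, s i ω ≠ t) → ∀ i, s i ω = s' i ω) (k : Fin m)
    (hle : payoff μ ℱ a X W (t + 1) s' k ≤ᵐ[μ] (fun ω => W (t + 1) ω k)) :
    payoff μ ℱ a X W t s k ≤ᵐ[μ]
      (fun ω => stagePayoff a (X t ω) (fun i => (μ[fun ω' => W (t + 1) ω' i | ℱ t]) ω)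
        {i | s i ω = t} k) := by
  filter_upwards [payoff_ae_eq_stagePayoff (a := a) hm ht hXmeas hXint hWint hs hs' hss' k,
    condExp_mono (m := ℱ t) integrable_condExp (hWint (t + 1) (by omega) ht k) hle] with ω e1 e2
  rw [e1]
  split_ifs with h
  · have hE : ({i | s i ω = t} : Finset (Fin m)) = ∅ := by simp [h]
    rw [hE]
    simp only [stagePayoff, Finset.notMem_empty, if_false, Finset.sum_empty, mul_zero, sub_zero]
    exact e2
  · exact le_rfl

/-- Turns a strategy into one for the next game without changing it where it exceeds `t`. -/
lemma max_succ_mem_strategies {t : ℕ} (ht : t < T) {σ : Ω → ℕ} (hσ : σ ∈ strategies ℱ T t) :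
    (fun ω => max (σ ω) (t + 1)) ∈ strategies ℱ T (t + 1) := by
  refine ⟨?_, fun ω => ⟨le_max_right _ _, max_le (hσ.2 ω).2 ht⟩⟩
  refine isStoppingTime_natCast_iff.2 fun u => ?_
  by_cases hu : t + 1 ≤ u
  · simpa [hu] using isStoppingTime_natCast_iff.1 hσ.1 u
  · simp [hu]

lemma U_last : U μ ℱ T a X T = X T := by
  rw [U, if_pos le_rfl]

lemma U_of_lt (hm : 0 < m) (ha : ∀ i, 0 < a i) (hsum : ∑ i, a i ≤ 1) {t : ℕ} (ht : t < T)
    (ω : Ω) : U μ ℱ T a X t ω = orthantProj a (X t ω)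
      (fun i => (μ[fun ω' => U μ ℱ T a X (t + 1) ω' i | ℱ t]) ω) := by
  rw [U, if_neg (not_le.2 ht)]
  exact proj_orthant_eq hm ha hsum _ _

/-- The closed form is needed here: the definition of `proj` by choice and limits does not exhibit
measurability. -/
theorem measurable_U (hm : 0 < m) (ha : ∀ i, 0 < a i) (hsum : ∑ i, a i ≤ 1)
    (hXmeas : ∀ u ≤ T, ∀ i, Measurable[ℱ u] (fun ω => X u ω i)) {t : ℕ} (ht : t ≤ T)
    (i : Fin m) : Measurable[ℱ t] (fun ω => U μ ℱ T a X t ω i) := by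
  rcases ht.eq_or_lt with rfl | h
  · rw [U_last]; exact hXmeas t le_rfl i
  · simp only [U_of_lt hm ha hsum h, orthantProj]
    have hP : ∀ i, Measurable[ℱ t] (μ[fun ω' => U μ ℱ T a X (t + 1) ω' i | ℱ t]) := fun i =>
      stronglyMeasurable_condExp.measurable
    have hd : ∀ j, Measurable[ℱ t] (fun ω => X t ω j -
        (μ[fun ω' => U μ ℱ T a X (t + 1) ω' j | ℱ t]) ω) := fun j => (hXmeas t ht j).sub (hP j)
    have hmax := (continuous_maxRatio a).measurable.comp ((@measurable_pi_iff _ _ _ (ℱ t) _ _).2 hd)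
    exact (hXmeas t ht i).max ((hP i).sub (hmax.const_mul _))

theorem integrable_U (hm : 0 < m) (ha : ∀ i, 0 < a i) (hsum : ∑ i, a i ≤ 1)
    (hXint : ∀ u ≤ T, ∀ i, Integrable (fun ω => X u ω i) μ) {t : ℕ} (ht : t ≤ T)
    (i : Fin m) : Integrable (fun ω => U μ ℱ T a X t ω i) μ := by
  rcases ht.eq_or_lt with rfl | h
  · rw [U_last]; exact hXint t le_rfl i
  · simp only [U_of_lt hm ha hsum h, orthantProj]
    refine (hXint t ht i).sup (integrable_condExp.sub (Integrable.const_mul ?_ _))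
    exact integrable_maxRatio a fun j => (hXint t ht j).sub integrable_condExp

lemma tau_mem_set {t : ℕ} (ht : t ≤ T) (i : Fin m) (ω : Ω) :
    t ≤ tau μ ℱ T a X t i ω ∧ tau μ ℱ T a X t i ω ≤ T ∧
      U μ ℱ T a X (tau μ ℱ T a X t i ω) ω i = X (tau μ ℱ T a X t i ω) ω i :=
  Nat.sInf_mem (s := {u | t ≤ u ∧ u ≤ T ∧ U μ ℱ T a X u ω i = X u ω i})
    ⟨T, ht, le_rfl, by rw [U_last]⟩

lemma tau_le {t u : ℕ} {i : Fin m} {ω : Ω} (htu : t ≤ u) (hu : u ≤ T)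
    (h : U μ ℱ T a X u ω i = X u ω i) : tau μ ℱ T a X t i ω ≤ u :=
  Nat.sInf_le ⟨htu, hu, h⟩

lemma tau_eq_self_iff {t : ℕ} (ht : t ≤ T) {i : Fin m} {ω : Ω} :
    tau μ ℱ T a X t i ω = t ↔ U μ ℱ T a X t ω i = X t ω i := by
  have h := tau_mem_set (μ := μ) (ℱ := ℱ) (a := a) (X := X) ht i ω
  refine ⟨fun e => ?_, fun e => le_antisymm (tau_le le_rfl ht e) h.1⟩
  rw [e] at h
  exact h.2.2

lemma tau_succ {t : ℕ} (ht : t < T) {i : Fin m} {ω : Ω} (h : tau μ ℱ T a X t i ω ≠ t) :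
    tau μ ℱ T a X t i ω = tau μ ℱ T a X (t + 1) i ω := by
  have h1 := tau_mem_set (μ := μ) (ℱ := ℱ) (a := a) (X := X) ht.le i ω
  have h2 := tau_mem_set (μ := μ) (ℱ := ℱ) (a := a) (X := X) (t := t + 1) ht i ω
  exact le_antisymm (tau_le (by omega) h2.2.1 h2.2.2) (tau_le (by omega) h1.2.1 h1.2.2)

theorem tau_mem_strategies (hm : 0 < m) (ha : ∀ i, 0 < a i) (hsum : ∑ i, a i ≤ 1)
    (hXmeas : ∀ u ≤ T, ∀ i, Measurable[ℱ u] (fun ω => X u ω i)) {t : ℕ} (ht : t ≤ T)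
    (i : Fin m) : tau μ ℱ T a X t i ∈ strategies ℱ T t := by
  refine ⟨isStoppingTime_natCast_iff.2 fun u => ?_, fun ω => ?_⟩
  · have : {ω | tau μ ℱ T a X t i ω ≤ u} =
        ⋃ v ∈ {v | t ≤ v ∧ v ≤ T ∧ v ≤ u}, {ω | U μ ℱ T a X v ω i = X v ω i} := by
      ext ω
      simp only [Set.mem_ofPred_eq, Set.mem_iUnion, exists_prop]
      refine ⟨fun h => ?_, fun ⟨v, hv, e⟩ => (tau_le hv.1 hv.2.1 e).trans hv.2.2⟩
      have h1 := tau_mem_set (μ := μ) (ℱ := ℱ) (a := a) (X := X) ht i ω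
      exact ⟨_, ⟨h1.1, h1.2.1, h⟩, h1.2.2⟩
    rw [this]
    refine MeasurableSet.biUnion (Set.to_countable _) fun v hv => ?_
    refine ℱ.mono hv.2.2 _ ?_
    exact measurableSet_eq_fun (measurable_U hm ha hsum hXmeas hv.2.1 i) (hXmeas v hv.2.1 i)
  · have h1 := tau_mem_set (μ := μ) (ℱ := ℱ) (a := a) (X := X) ht i ω
    exact ⟨h1.1, h1.2.1⟩

/-- The two inequalities that make `τ` an optimal equilibrium, in the game on `[t, T]` whose later
values are versions `W` of the `U_u`. -/
theorem payoff_update_tau (hm : 0 < m) [IsFiniteMeasure μ] (ha : ∀ i, 0 < a i)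
    (hsum : ∑ i, a i ≤ 1)
    (hXmeas : ∀ u ≤ T, ∀ i, Measurable[ℱ u] (fun ω => X u ω i))
    (hXint : ∀ u ≤ T, ∀ i, Integrable (fun ω => X u ω i) μ) {t : ℕ} (ht : t ≤ T)
    (hW : ∀ u, t < u → u ≤ T → ∀ i, (fun ω => W u ω i) =ᵐ[μ] fun ω => U μ ℱ T a X u ω i)
    (k : Fin m) :
    (∀ s : Fin m → Ω → ℕ, (∀ i, s i ∈ strategies ℱ T t) → (fun ω => U μ ℱ T a X t ω k) ≤ᵐ[μ]
      payoff μ ℱ a X W t (Function.update s k (tau μ ℱ T a X t k)) k) ∧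
    (∀ x ∈ strategies ℱ T t, payoff μ ℱ a X W t (Function.update (tau μ ℱ T a X t) k x) k ≤ᵐ[μ]
      fun ω => U μ ℱ T a X t ω k) := by
  induction ht using Nat.decreasingInduction with
  | self =>
    have hτ := tau_mem_strategies (μ := μ) hm ha hsum hXmeas le_rfl
    refine ⟨fun s hs => ?_, fun x hx => ?_⟩
    · rw [payoff_last hm (hXmeas T le_rfl) (hXint T le_rfl) (update_mem hs k (hτ k)), U_last]
    · rw [payoff_last hm (hXmeas T le_rfl) (hXint T le_rfl) (update_mem hτ k hx), U_last]
  | of_succ t ht ih =>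
    obtain ⟨ih1, ih2⟩ := ih fun u hu => hW u (by omega)
    have hτ := tau_mem_strategies (μ := μ) hm ha hsum hXmeas ht.le
    have hτ' := tau_mem_strategies (μ := μ) hm ha hsum hXmeas (Nat.succ_le_of_lt ht)
    have hWint : ∀ u, t < u → u ≤ T → ∀ i, Integrable (fun ω => W u ω i) μ := fun u h1 h2 i =>
      (integrable_U hm ha hsum hXint h2 i).congr (hW u h1 h2 i).symm
    have hWk := hW (t + 1) (by omega) ht k
    have hP : ∀ᵐ ω ∂μ, (fun i => (μ[fun ω' => W (t + 1) ω' i | ℱ t]) ω) =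
        fun i => (μ[fun ω' => U μ ℱ T a X (t + 1) ω' i | ℱ t]) ω := by
      filter_upwards [ae_all_iff.2 fun i =>
        condExp_congr_ae (m := ℱ t) (hW (t + 1) (by omega) ht i)] with ω hω
      funext i
      exact hω i
    refine ⟨fun s hs => ?_, fun x hx => ?_⟩
    -- The opponents' strategies are raised to `t + 1`, while `k` switches to `τ` of the next game,
    -- which agrees with the present one unless `k` stops at `t`.
    · have hs' := fun i => max_succ_mem_strategies ht (hs i)
      have h1 := stagePayoff_le_payoff (a := a) hm ht (hXmeas t ht.le) hXint hWint
        (update_mem hs k (hτ k)) (update_mem hs' k (hτ' k)) (fun ω hω i => by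
          by_cases hik : i = k
          · subst hik
            have := hω i
            simp only [Function.update_self] at this ⊢
            exact tau_succ ht this
          · have := hω i
            have h2 := ((hs i).2 ω).1
            simp only [Function.update_of_ne hik] at this ⊢
            omega) k (hWk.le.trans (ih1 _ hs'))
      filter_upwards [h1, hP] with ω e1 e2
      refine le_trans ?_ e1
      rw [e2, U_of_lt hm ha hsum ht]
      refine orthantProj_le_stagePayoff ha hsum _ _ ?_
      rw [← U_of_lt hm ha hsum ht, ← tau_eq_self_iff ht.le]
      simp
    · have hx' := max_succ_mem_strategies ht hx
      have h1 := payoff_le_stagePayoff (a := a) hm ht (hXmeas t ht.le) hXint hWint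
        (update_mem hτ k hx) (update_mem hτ' k hx') (fun ω hω i => by
          by_cases hik : i = k
          · subst hik
            have := hω i
            have h2 := (hx.2 ω).1
            simp only [Function.update_self] at this ⊢
            omega
          · have := hω i
            simp only [Function.update_of_ne hik] at this ⊢
            exact tau_succ ht this) k ((ih2 _ hx').trans hWk.symm.le)
      filter_upwards [h1, hP] with ω e1 e2
      refine e1.trans ?_
      rw [e2, U_of_lt hm ha hsum ht]
      refine stagePayoff_le_orthantProj hm ha hsum _ _ fun i hik => ?_
      rw [← U_of_lt hm ha hsum ht, ← tau_eq_self_iff ht.le]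
      simp [Function.update_of_ne hik]

theorem U_ae_eq_payoff_tau (hm : 0 < m) [IsFiniteMeasure μ] (ha : ∀ i, 0 < a i)
    (hsum : ∑ i, a i ≤ 1)
    (hXmeas : ∀ u ≤ T, ∀ i, Measurable[ℱ u] (fun ω => X u ω i))
    (hXint : ∀ u ≤ T, ∀ i, Integrable (fun ω => X u ω i) μ) {t : ℕ} (ht : t ≤ T)
    (hW : ∀ u, t < u → u ≤ T → ∀ i, (fun ω => W u ω i) =ᵐ[μ] fun ω => U μ ℱ T a X u ω i)
    (k : Fin m) :
    (fun ω => U μ ℱ T a X t ω k) =ᵐ[μ] payoff μ ℱ a X W t (tau μ ℱ T a X t) k := by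
  obtain ⟨h1, h2⟩ := payoff_update_tau hm ha hsum hXmeas hXint ht hW k
  have hτ := tau_mem_strategies (μ := μ) hm ha hsum hXmeas ht
  have h1 := h1 _ hτ
  have h2 := h2 _ (hτ k)
  rw [Function.update_eq_self] at h1 h2
  exact h1.antisymm h2

theorem isOptimalEquilibrium_tau (hm : 0 < m) [IsFiniteMeasure μ] (ha : ∀ i, 0 < a i)
    (hsum : ∑ i, a i ≤ 1)
    (hXmeas : ∀ u ≤ T, ∀ i, Measurable[ℱ u] (fun ω => X u ω i))
    (hXint : ∀ u ≤ T, ∀ i, Integrable (fun ω => X u ω i) μ) {t : ℕ} (ht : t ≤ T)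
    (hW : ∀ u, t < u → u ≤ T → ∀ i, (fun ω => W u ω i) =ᵐ[μ] fun ω => U μ ℱ T a X u ω i) :
    IsOptimalEquilibrium μ (strategies ℱ T t) (payoff μ ℱ a X W t) (tau μ ℱ T a X t) := by
  refine ⟨tau_mem_strategies hm ha hsum hXmeas ht, fun k => ?_⟩
  obtain ⟨h1, h2⟩ := payoff_update_tau hm ha hsum hXmeas hXint ht hW k
  have h := U_ae_eq_payoff_tau hm ha hsum hXmeas hXint ht hW k
  exact ⟨fun s' hs' => h.symm.le.trans (h1 s' hs'), fun x hx => (h2 x hx).trans h.le⟩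

theorem isGameValue_U (hm : 0 < m) [IsFiniteMeasure μ] (ha : ∀ i, 0 < a i)
    (hsum : ∑ i, a i ≤ 1)
    (hXmeas : ∀ u ≤ T, ∀ i, Measurable[ℱ u] (fun ω => X u ω i))
    (hXint : ∀ u ≤ T, ∀ i, Integrable (fun ω => X u ω i) μ) {t : ℕ} (ht : t ≤ T)
    (hW : ∀ u, t < u → u ≤ T → ∀ i, (fun ω => W u ω i) =ᵐ[μ] fun ω => U μ ℱ T a X u ω i) :
    IsGameValue μ ℱ T a X W t (U μ ℱ T a X t) :=
  (isOptimalEquilibrium_tau hm ha hsum hXmeas hXint ht hW).isValue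
    (measurable_U hm ha hsum hXmeas ht) (U_ae_eq_payoff_tau hm ha hsum hXmeas hXint ht hW)

/-- Once the values after time `u` agree with `U`, both `W u` and `U` at `u` are values of the same
game, hence almost surely equal. -/
theorem AreLaterValues.ae_eq_U (hm : 0 < m) [IsFiniteMeasure μ] (ha : ∀ i, 0 < a i)
    (hsum : ∑ i, a i ≤ 1)
    (hXmeas : ∀ u ≤ T, ∀ i, Measurable[ℱ u] (fun ω => X u ω i))
    (hXint : ∀ u ≤ T, ∀ i, Integrable (fun ω => X u ω i) μ) {t : ℕ} (ht : t ≤ T)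
    (hW : AreLaterValues μ ℱ T a X W t) :
    ∀ u, t < u → u ≤ T → ∀ i, (fun ω => W u ω i) =ᵐ[μ] fun ω => U μ ℱ T a X u ω i := by
  induction ht using Nat.decreasingInduction with
  | self => exact fun u h1 h2 => absurd h2 (not_le.2 h1)
  | of_succ t ht ih =>
    have h := ih fun u hu => hW u (by omega)
    intro u hu huT i
    rcases (Nat.succ_le_of_lt hu).eq_or_lt with rfl | h1
    · exact (hW _ hu huT).ae_eq (isGameValue_U hm ha hsum hXmeas hXint huT h) i
    · exact h u h1 huT i

end Game

end StoppingGame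

open StoppingGame in
theorem theorem5p4 {Ω : Type*} [mΩ : MeasurableSpace Ω] (μ : Measure Ω) [IsProbabilityMeasure μ]
    (ℱ : Filtration ℕ mΩ) (T : ℕ) (m : ℕ) (hm : 0 < m)
    (a : Fin m → ℝ) (ha : ∀ i, 0 < a i) (hsum : ∑ i, a i ≤ 1)
    (X : ℕ → Ω → Fin m → ℝ)
    (hXmeas : ∀ u ≤ T, ∀ i, Measurable[ℱ u] (fun ω => X u ω i))
    (hXint : ∀ u ≤ T, ∀ i, Integrable (fun ω => X u ω i) μ) :
    -- each `U_t` is an integrable `ℱ_t`-measurable vector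
    (∀ t ≤ T, ∀ i, Measurable[ℱ t] (fun ω => U μ ℱ T a X t ω i) ∧
      Integrable (fun ω => U μ ℱ T a X t ω i) μ) ∧
    -- the recursively defined games have values, namely the `U_t`
    (∀ t ≤ T, IsGameValue μ ℱ T a X (U μ ℱ T a X) t (U μ ℱ T a X t)) ∧
    -- whichever versions `W` of the values of the later games are used in the game on `[t, T]`:
    ∀ t ≤ T, ∀ W : ℕ → Ω → Fin m → ℝ, AreLaterValues μ ℱ T a X W t →
      -- the payoffs are well defined
      (∀ s : Fin m → Ω → ℕ, (∀ i, s i ∈ strategies ℱ T t) →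
        ∀ k, Integrable (outcome a X W s k) μ) ∧
      -- `U_t` is the payoff of the profile `τ`
      (∀ k, (fun ω => U μ ℱ T a X t ω k) =ᵐ[μ]
        payoff μ ℱ a X W t (tau μ ℱ T a X t) k) ∧
      -- `τ` is an optimal equilibrium
      IsOptimalEquilibrium μ (strategies ℱ T t) (payoff μ ℱ a X W t) (tau μ ℱ T a X t) ∧
      -- `U_t` is the value, and the value is almost surely unique
      IsGameValue μ ℱ T a X W t (U μ ℱ T a X t) ∧
      ∀ v, IsGameValue μ ℱ T a X W t v → ∀ k, (fun ω => v ω k) =ᵐ[μ]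
        (fun ω => U μ ℱ T a X t ω k) := by
  refine ⟨fun t ht i => ⟨measurable_U hm ha hsum hXmeas ht i, integrable_U hm ha hsum hXint ht i⟩,
    fun t ht => isGameValue_U hm ha hsum hXmeas hXint ht fun _ _ _ _ => EventuallyEq.rfl,
    fun t ht W hW => ?_⟩
  have hWU := hW.ae_eq_U hm ha hsum hXmeas hXint ht
  have hval := isGameValue_U hm ha hsum hXmeas hXint ht hWU
  exact ⟨fun s hs k => integrable_outcome hm hXint
      (fun u h1 h2 i => (integrable_U hm ha hsum hXint h2 i).congr (hWU u h1 h2 i).symm) hs k,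
    U_ae_eq_payoff_tau hm ha hsum hXmeas hXint ht hWU,
    isOptimalEquilibrium_tau hm ha hsum hXmeas hXint ht hWU, hval,
    fun v hv k => IsValue.ae_eq hv hval k⟩
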